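/- Consider a cooperative Dec-POMDP with $N\ge 1$ agents: a state set $S$, finite action sets $A_i$, observation sets $O_i$, transition probabilities $P(s'\mid s,a)$ (for each $(s,a)$ a probability mass function on $S$, where $a=(a_1,\dots,a_N)$), a bounded team reward $R(s,a)$, a deterministic observation function $s\mapsto(\Omega_i(s))_{i}\in\prod_i O_i$, a discount factor $\gamma\in[0,1)$, and an initial state distribution. Agent $i$ uses a parametrized policy $\pi_i(a_i\mid o_i;\theta_i)$ with $\theta_i\in\mathbb{R}^d$, and given the state the agents act independently. Let $\theta=(\theta_1,\dots,\theta_N)\in\mathbb{R}^D$, $D=Nd$, and let $J(\theta)=\mathbb{E}\big[\sum_{t\ge0}\gamma^tR(s_t,a_t)\big]$ be the expected discounted return. Let $g_i(\theta)=\nabla_{\theta_i}J(\theta)\in\mathbb{R}^d$ be the local gradients, let $$u^*(\theta)=\operatorname*{argmin}_{u\in\operatorname{conv}\{g_1(\theta),\dots,g_N(\theta)\}}\|u\|^2$$ be the consensus gradient, and for a learning rate $\eta>0$ let $T$ be the GRASP update map $$T(\theta)=\big(\theta_i+\eta\,(g_i(\theta)+u^*(\theta))\big)_{i=1}^N .$$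 Let $\Theta\subset\mathbb{R}^D$ be nonempty, compact and convex. Assume that the policies are continuously differentiable in their parameters near $\Theta$: for each $i$ there is an open set $V_i\supseteq\{\theta_i:\theta\in\Theta\}$ on which, for every action $a_i$, all functions $\theta_i\mapsto\pi_i(a_i\mid o_i;\theta_i)$, $o_i\in O_i$, are continuously differentiable, with derivatives forming an equicontinuous family indexed by $o_i$ (which is automatic when $O_i$ is finite). Assume also $T(\Theta)\subseteq\Theta$. Then there is $\theta^*\in\Theta$ with $T(\theta^*)=\theta^*$ which is a consensus equilibrium point, that is, $u^*(\theta^*)=0$. -/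

import Mathlib

noncomputable section

namespace GRASP

universe u v w

/-- A cooperative Dec-POMDP with `N` agents: state set `S`, action sets `A i`, observation sets
`O i`, transition probabilities `P(s' | s, a)`, a bounded team reward `R(s, a)`, a deterministic
observation function, a discount factor in `[0, 1)`, and the law of the initial state. -/
structure DecPOMDP (N : ℕ) (S : Type u) (A : Fin N → Type v) (O : Fin N → Type w) where
  transition : S → (∀ i, A i) → PMF S
  reward : S → (∀ i, A i) → ℝ
  reward_bounded : ∃ Rmax : ℝ, ∀ s a, |reward s a| ≤ Rmax
  observe : S → ∀ i, O i
  discount : ℝ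
  discount_nonneg : 0 ≤ discount
  discount_lt_one : discount < 1
  init : PMF S

/-- The parameter vector of a single agent, an element of `ℝ^d`. -/
abbrev AgentParam (d : ℕ) : Type := EuclideanSpace ℝ (Fin d)

/-- A joint parameter `θ = (θ_1, …, θ_N)`, an element of `ℝ^D` with `D = N * d`. -/
abbrev JointParam (N d : ℕ) : Type := Fin N → AgentParam d

/-- Parametrized local policies: `π i o x` is the distribution `π_i(· | o; x)` of the action of
agent `i` given its observation `o`, when its parameter is `x`. -/
abbrev PolicyFamily (N d : ℕ) (A : Fin N → Type v) (O : Fin N → Type w) :=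
  ∀ i : Fin N, O i → AgentParam d → PMF (A i)

/-- The policies are continuously differentiable in their parameters near `Θ`, uniformly in the
observation: for every agent `i` there is an open set containing all `θ i` with `θ ∈ Θ`, on which
each action probability is continuously differentiable and, for each action, the derivatives
belonging to the various observations form an equicontinuous family (for finite `O i` the second
property follows from the first). -/
def IsC1Near {N d : ℕ} {A : Fin N → Type v} {O : Fin N → Type w}
    (π : PolicyFamily N d A O) (Θ : Set (JointParam N d)) : Prop :=
  ∀ i : Fin N, ∃ V : Set (AgentParam d), IsOpen V ∧ (∀ θ ∈ Θ, θ i ∈ V) ∧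
    ∀ a : A i,
      (∀ o : O i, ContDiffOn ℝ 1 (fun x => (π i o x a).toReal) V) ∧
      EquicontinuousOn (fun (o : O i) (x : AgentParam d) =>
        fderiv ℝ (fun y => (π i o y a).toReal) x) V

section Return

variable {N d : ℕ} {S : Type u} {A : Fin N → Type v} {O : Fin N → Type w}
  [∀ i, Fintype (A i)]

/-- The law of the joint action in state `s`: given their observations, the agents draw their
actions independently, `π(a | s) = ∏ i, π_i(a_i | o_i; θ_i)`. -/
def jointAction (M : DecPOMDP N S A O) (π : PolicyFamily N d A O) (θ : JointParam N d) (s : S) :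
    PMF (∀ i, A i) :=
  PMF.ofFintype (fun a => ∏ i, π i (M.observe s i) (θ i) (a i)) (by
    have h : ∀ i, ∑ b : A i, π i (M.observe s i) (θ i) b = 1 := fun i => by
      rw [← tsum_fintype (L := SummationFilter.unconditional _)]
      exact PMF.tsum_coe _
    rw [← Fintype.piFinset_univ, ← Finset.prod_univ_sum]
    simp [h])

/-- The law of the state `s_t` under the joint policy with parameter `θ`. -/
def stateLaw (M : DecPOMDP N S A O) (π : PolicyFamily N d A O) (θ : JointParam N d) : ℕ → PMF S
  | 0 => M.init
  | t + 1 => (stateLaw M π θ t).bind fun s => (jointAction M π θ s).bind fun a => M.transition s a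

/-- The expected team reward `E[R(s_t, a_t)]` at time `t`. -/
def expectedReward (M : DecPOMDP N S A O) (π : PolicyFamily N d A O) (θ : JointParam N d)
    (t : ℕ) : ℝ :=
  ∑' s : S, (stateLaw M π θ t s).toReal * ∑ a, (jointAction M π θ s a).toReal * M.reward s a

/-- The expected discounted return `J(θ) = ∑ t, γ ^ t * E[R(s_t, a_t)]`. -/
def expectedReturn (M : DecPOMDP N S A O) (π : PolicyFamily N d A O) (θ : JointParam N d) : ℝ :=
  ∑' t : ℕ, M.discount ^ t * expectedReward M π θ t

/-- The local gradient `g_i(θ) = ∇_{θ_i} J(θ)`, with the other agents' parameters held fixed. -/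
def localGradient (M : DecPOMDP N S A O) (π : PolicyFamily N d A O) (θ : JointParam N d)
    (i : Fin N) : AgentParam d :=
  gradient (fun x => expectedReturn M π (Function.update θ i x)) (θ i)

end Return

/-- The convex hull of finitely many (and at least one) vectors has a point of minimal norm. -/
theorem exists_minNorm {N d : ℕ} [NeZero N] (g : Fin N → AgentParam d) :
    ∃ u ∈ convexHull ℝ (Set.range g), IsMinOn (fun x => ‖x‖ ^ 2) (convexHull ℝ (Set.range g)) u :=
  ((Set.finite_range g).isCompact_convexHull ℝ).exists_isMinOn
    (Set.range_nonempty g).convexHull (by fun_prop)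

/-- The (unique) minimizer of `‖u‖²` over the convex hull of `g_1, …, g_N`. -/
def minNormPoint {N d : ℕ} [NeZero N] (g : Fin N → AgentParam d) : AgentParam d :=
  (exists_minNorm g).choose

section Update

variable {N d : ℕ} [NeZero N] {S : Type u} {A : Fin N → Type v} {O : Fin N → Type w}
  [∀ i, Fintype (A i)]

/-- The consensus gradient `u*(θ)`: the minimum-norm point of the convex hull of the local
gradients. -/
def consensusGradient (M : DecPOMDP N S A O) (π : PolicyFamily N d A O) (θ : JointParam N d) :
    AgentParam d :=
  minNormPoint (localGradient M π θ)

/-- The update map `θ ↦ θ + η (g(θ) + u*(θ))`, that is `θ_i ↦ θ_i + η (g_i(θ) + u*(θ))` for every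
agent `i`. -/
def update (M : DecPOMDP N S A O) (π : PolicyFamily N d A O) (η : ℝ) (θ : JointParam N d) :
    JointParam N d :=
  fun i => θ i + η • (localGradient M π θ i + consensusGradient M π θ)

/-- A consensus equilibrium point: the consensus gradient vanishes. -/
def IsConsensusEquilibrium (M : DecPOMDP N S A O) (π : PolicyFamily N d A O)
    (θ : JointParam N d) : Prop :=
  consensusGradient M π θ = 0

end Update

end GRASP

end

open scoped BoundedContinuousFunction Topology

noncomputable section

namespace GRASP

/-! ### Minimum-norm points and maximizers on convex sets -/

/-! No topological fixed-point theorem is needed: a maximizer `θ` of `J` over the compact set `Θ` is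
the required point. Since `T θ ∈ Θ` and `Θ` is convex, `J` has nonpositive derivative at `θ` along
`T θ - θ`. That derivative is `η * ∑ i, (‖g i‖² + ⟪u, g i⟫)`, and minimality of `u` on the hull
gives `⟪u, g i⟫ ≥ ‖u‖²`. Hence every `g i` and `u` vanish, and `T θ = θ`.

The analytic work is the differentiability of `J` on `Θ`. On bounded functions of the state, `J =
E_init[(1 - γ K)⁻¹ r]`, where the transition operator `K` and the one-step reward `r` depend on `θ`
only through the joint action probabilities. Equicontinuity of the policy derivatives makes these
differentiable in the sup norm (`differentiableAt_bcf_of_equicontinuousOn`), and inversion is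
differentiable at units (`differentiableAt_tsum_pow_mul`). -/

theorem norm_sq_minNormPoint_le_inner {N d : ℕ} [NeZero N] (g : Fin N → AgentParam d)
    (i : Fin N) : ‖minNormPoint g‖ ^ 2 ≤ inner ℝ (minNormPoint g) (g i) := by
  obtain ⟨hmem, hmin⟩ := (exists_minNorm g).choose_spec
  change minNormPoint g ∈ _ at hmem
  change IsMinOn _ _ (minNormPoint g) at hmin
  set u := minNormPoint g
  have hi : g i ∈ convexHull ℝ (Set.range g) := subset_convexHull ℝ _ ⟨i, rfl⟩
  -- The segment from `u` to `g i` stays in the hull, so the derivative `2 * ⟪u, g i - u⟫` of `‖·‖²`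
  -- at `u` is nonnegative.
  have hcone : g i - u ∈ posTangentConeAt (convexHull ℝ (Set.range g)) u := by
    apply mem_posTangentConeAt_of_segment_subset
    simpa using (convex_convexHull ℝ _).segment_subset hmem hi
  have h := hmin.localize.hasFDerivWithinAt_nonneg
    (hasStrictFDerivAt_norm_sq u).hasFDerivAt.hasFDerivWithinAt hcone
  simp only [_root_.smul_apply, innerSL_apply_apply, inner_sub_right,
    real_inner_self_eq_norm_sq] at h
  simp only [nsmul_eq_mul] at h
  push_cast at h
  linarith

theorem fderiv_sub_nonpos_of_isMaxOn {E : Type*} [NormedAddCommGroup E] [NormedSpace ℝ E]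
    {f : E → ℝ} {s : Set E} {x y : E} (hs : Convex ℝ s) (hx : x ∈ s) (hy : y ∈ s)
    (hmax : IsMaxOn f s x) (hf : DifferentiableAt ℝ f x) : fderiv ℝ f x (y - x) ≤ 0 := by
  refine hmax.localize.hasFDerivWithinAt_nonpos hf.hasFDerivAt.hasFDerivWithinAt ?_
  apply mem_posTangentConeAt_of_segment_subset
  simpa using hs.segment_subset hx hy

/-- Links the agents' separate gradients to the joint derivative; this is where joint
differentiability of the return is used. -/
theorem fderiv_apply_eq_sum_inner_gradient {N d : ℕ} {f : JointParam N d → ℝ}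
    {θ : JointParam N d} (hf : DifferentiableAt ℝ f θ) (v : JointParam N d) :
    fderiv ℝ f θ v =
      ∑ i, inner ℝ (gradient (fun x => f (Function.update θ i x)) (θ i)) (v i) := by
  have h (i : Fin N) : inner ℝ (gradient (fun x => f (Function.update θ i x)) (θ i)) (v i) =
      fderiv ℝ f θ (Pi.single i (v i)) := by
    have hf' : HasFDerivAt f (fderiv ℝ f θ) (Function.update θ i (θ i)) := by
      simpa using hf.hasFDerivAt
    have hcomp := (hf'.comp (θ i) (hasFDerivAt_update θ (θ i))).fderiv
    rw [inner_gradient_left]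
    refine (DFunLike.congr_fun hcomp (v i)).trans ?_
    simp only [ContinuousLinearMap.comp_apply]
    congr 1
    ext j : 1
    rcases eq_or_ne j i with rfl | hj
    · simp
    · simp [hj]
  simp_rw [h, ← map_sum, LinearMap.sum_single_apply]

/-! ### Differentiability of bounded families of functions -/

section Family

variable {S : Type*} [TopologicalSpace S] [DiscreteTopology S]
  {E : Type*} [NormedAddCommGroup E] [NormedSpace ℝ E]

/-- A uniformly bounded family of functions which is equidifferentiable at a point is
differentiable there, as a map into the bounded functions on the index set. -/
theorem differentiableAt_bcf_of_equicontinuousOn {p : E → S →ᵇ ℝ} {C : ℝ}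
    (hC : ∀ x, ‖p x‖ ≤ C) {V : Set E} (hV : IsOpen V) {x₀ : E} (hx₀ : x₀ ∈ V)
    (hd : ∀ s, DifferentiableOn ℝ (fun x => p x s) V)
    (he : EquicontinuousOn (fun s x => fderiv ℝ (fun y => p y s) x) V) :
    DifferentiableAt ℝ p x₀ := by
  set D : S → E →L[ℝ] ℝ := fun s => fderiv ℝ (fun y => p y s) x₀ with hD
  -- Equicontinuity gives one `δ` for all `s`; the mean value inequality on the ball then bounds the
  -- remainders uniformly.
  have key : ∀ ε > 0, ∃ δ > 0, ∀ x, ‖x - x₀‖ < δ → ∀ s,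
      ‖p x s - p x₀ s - D s (x - x₀)‖ ≤ ε * ‖x - x₀‖ := by
    intro ε hε
    have h1 : ∀ᶠ x in 𝓝 x₀, ∀ s, ‖fderiv ℝ (fun y => p y s) x - D s‖ ≤ ε ∧ x ∈ V := by
      have := he x₀ hx₀ _ (Metric.dist_mem_uniformity hε)
      rw [hV.nhdsWithin_eq hx₀] at this
      filter_upwards [this, hV.mem_nhds hx₀] with x hx hxV s
      have h : dist (D s) (fderiv ℝ (fun y => p y s) x) < ε := hx s
      rw [dist_comm, dist_eq_norm] at h
      exact ⟨h.le, hxV⟩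
    obtain ⟨δ, hδ, hball⟩ := Metric.eventually_nhds_iff_ball.1 h1
    refine ⟨δ, hδ, fun x hx s => ?_⟩
    exact Convex.norm_image_sub_le_of_norm_fderiv_le' (𝕜 := ℝ) (f := fun y => p y s)
      (fun y hy => (hd s).differentiableAt (hV.mem_nhds (hball y hy s).2))
      (fun y hy => (hball y hy s).1) (convex_ball x₀ δ) (Metric.mem_ball_self hδ)
      (by rwa [Metric.mem_ball, dist_eq_norm])
  obtain ⟨δ₁, hδ₁, h₁⟩ := key 1 one_pos
  have hC0 : 0 ≤ C := (norm_nonneg _).trans (hC x₀)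
  have hpC : ∀ x s, ‖p x s‖ ≤ C := fun x s => ((p x).norm_coe_le_norm s).trans (hC x)
  -- The derivatives `D s` are bounded uniformly in `s`: on a vector of length `δ₁ / 2`, `D s` is at
  -- most two values of `p` (each at most `C`) plus the remainder for `ε = 1`. So they assemble into
  -- one operator `φ`.
  set K : ℝ := (C + C + δ₁ / 2) / (δ₁ / 2) with hK
  have hK0 : 0 ≤ K := by positivity
  have hbound : ∀ s v, ‖D s v‖ ≤ K * ‖v‖ := by
    intro s v
    rcases eq_or_ne v 0 with rfl | hv
    · simp
    have hv' : 0 < ‖v‖ := norm_pos_iff.2 hv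
    have hw : ‖(δ₁ / 2 / ‖v‖) • v‖ = δ₁ / 2 := by
      rw [norm_smul, Real.norm_of_nonneg (by positivity)]
      field_simp
    have h := h₁ (x₀ + (δ₁ / 2 / ‖v‖) • v) (by rw [add_sub_cancel_left, hw]; linarith) s
    rw [add_sub_cancel_left, hw, one_mul] at h
    have h2 : ‖D s ((δ₁ / 2 / ‖v‖) • v)‖ ≤ C + C + δ₁ / 2 := by
      have a1 := hpC (x₀ + (δ₁ / 2 / ‖v‖) • v) s
      have a2 := hpC x₀ s
      rw [Real.norm_eq_abs, abs_le] at *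
      constructor <;> linarith [a1.1, a1.2, a2.1, a2.2, h.1, h.2]
    rw [map_smul, norm_smul, Real.norm_of_nonneg (by positivity)] at h2
    rw [hK, div_mul_eq_mul_div, le_div_iff₀ (by positivity)]
    calc ‖D s v‖ * (δ₁ / 2) = (δ₁ / 2 / ‖v‖ * ‖D s v‖) * ‖v‖ := by field_simp
      _ ≤ _ := by gcongr
  let φ : E →L[ℝ] (S →ᵇ ℝ) := LinearMap.mkContinuous
    { toFun := fun v => BoundedContinuousFunction.ofNormedAddCommGroupDiscrete
        (fun s => D s v) (K * ‖v‖) (fun s => hbound s v)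
      map_add' := fun v w => by ext s; simp
      map_smul' := fun c v => by ext s; simp } K
    (fun v => (BoundedContinuousFunction.norm_le (by positivity)).2 (fun s => hbound s v))
  refine HasFDerivAt.differentiableAt (f' := φ) ?_
  rw [hasFDerivAt_iff_isLittleO, Asymptotics.isLittleO_iff]
  intro ε hε
  obtain ⟨δ, hδ, h⟩ := key ε hε
  filter_upwards [Metric.ball_mem_nhds x₀ hδ] with x hx
  rw [Metric.mem_ball, dist_eq_norm] at hx
  exact (BoundedContinuousFunction.norm_le (by positivity)).2 (fun s => h x hx s)

end Family

/-! ### Discounted sums of powers of a contraction -/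

section Resolvent

variable {B : Type*} [NormedAddCommGroup B] [NormedSpace ℝ B] [CompleteSpace B]

/-- Neumann series; the closed form avoids differentiating the discounted sum term by term. -/
theorem tsum_pow_mul_eq_inverse {c : ℝ} (hc0 : 0 ≤ c) (hc : c < 1) {T : B →L[ℝ] B}
    (hT : ‖T‖ ≤ 1) (φ : B →L[ℝ] ℝ) (f : B) :
    ∑' t : ℕ, c ^ t * φ ((T ^ t) f) = φ (Ring.inverse (1 - c • T) f) := by
  have hnorm : ‖c • T‖ < 1 := by
    rw [norm_smul, Real.norm_of_nonneg hc0]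
    nlinarith [norm_nonneg T]
  have hs := (summable_geometric_of_norm_lt_one hnorm).hasSum
  have hinv : Ring.inverse (1 - c • T) = ∑' t : ℕ, (c • T) ^ t := by
    rw [NormedRing.inverse_one_sub _ hnorm]; rfl
  rw [← hinv] at hs
  have h := hs.mapL (φ.comp (ContinuousLinearMap.apply ℝ B f))
  refine Eq.trans (tsum_congr fun t => ?_) h.tsum_eq
  simp [smul_pow]

theorem differentiableAt_tsum_pow_mul {E : Type*} [NormedAddCommGroup E] [NormedSpace ℝ E]
    {c : ℝ} (hc0 : 0 ≤ c) (hc : c < 1) {T : E → B →L[ℝ] B} (hT : ∀ x, ‖T x‖ ≤ 1)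
    (φ : B →L[ℝ] ℝ) {f : E → B} {x : E} (hTd : DifferentiableAt ℝ T x)
    (hfd : DifferentiableAt ℝ f x) :
    DifferentiableAt ℝ (fun y => ∑' t : ℕ, c ^ t * φ ((T y ^ t) (f y))) x := by
  simp_rw [fun y => tsum_pow_mul_eq_inverse hc0 hc (hT y) φ (f y)]
  have hunit : IsUnit (1 - c • T x) := by
    refine isUnit_one_sub_of_norm_lt_one ?_
    rw [norm_smul, Real.norm_of_nonneg hc0]
    nlinarith [norm_nonneg (T x), hT x]
  have hinv : DifferentiableAt ℝ (fun y => Ring.inverse (1 - c • T y)) x :=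
    (differentiableAt_inverse (𝕜 := ℝ) hunit).comp (f := fun y => 1 - c • T y) x
      ((differentiableAt_const _).sub (hTd.const_smul c))
  exact φ.differentiableAt.comp x (hinv.clm_apply hfd)

end Resolvent

theorem differentiableAt_sum_mul_comp {ι R E : Type*} [Fintype ι] [NormedRing R]
    [NormedAlgebra ℝ R] [NormedAddCommGroup E] [NormedSpace ℝ E] {p : ι → E → R}
    (T : ι → R →L[ℝ] R) {x : E} (hp : ∀ a, DifferentiableAt ℝ (p a) x) :
    DifferentiableAt ℝ (fun y => ∑ a, (ContinuousLinearMap.mul ℝ R (p a y)).comp (T a)) x := by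
  have h (a : ι) : DifferentiableAt ℝ (fun y => ContinuousLinearMap.mul ℝ R (p a y)) x :=
    (ContinuousLinearMap.mul ℝ R).differentiableAt.comp x (hp a)
  exact DifferentiableAt.fun_sum fun a _ => (h a).clm_comp (differentiableAt_const _)

/-! ### Expectations of bounded functions -/

theorem summable_toReal_mul {α : Type*} (p : PMF α) {f : α → ℝ} {C : ℝ} (hf : ∀ a, |f a| ≤ C) :
    Summable fun a => (p a).toReal * f a := by
  have hp : Summable fun a => (p a).toReal := ENNReal.summable_toReal (by simp [p.tsum_coe])
  refine Summable.of_norm_bounded (hp.mul_right C) fun a => ?_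
  rw [norm_mul, Real.norm_of_nonneg ENNReal.toReal_nonneg]
  exact mul_le_mul_of_nonneg_left (hf a) ENNReal.toReal_nonneg

theorem tsum_toReal {α : Type*} (p : PMF α) : ∑' a, (p a).toReal = 1 := by
  rw [← ENNReal.tsum_toReal_eq p.apply_ne_top, p.tsum_coe, ENNReal.toReal_one]

theorem abs_tsum_toReal_mul_le {α : Type*} (p : PMF α) {f : α → ℝ} {C : ℝ}
    (hf : ∀ a, |f a| ≤ C) : |∑' a, (p a).toReal * f a| ≤ C := by
  have hp : Summable fun a => (p a).toReal := ENNReal.summable_toReal (by simp [p.tsum_coe])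
  have h : HasSum (fun a => (p a).toReal * C) C := by
    have := hp.hasSum.mul_right C
    rwa [tsum_toReal, one_mul] at this
  rw [← Real.norm_eq_abs]
  refine tsum_of_norm_bounded h fun a => ?_
  rw [norm_mul, Real.norm_of_nonneg ENNReal.toReal_nonneg]
  exact mul_le_mul_of_nonneg_left (hf a) ENNReal.toReal_nonneg

/-- Fubini: the joint law of the pair has total mass one and `f` is bounded, so the double sum
converges absolutely. -/
theorem tsum_bind_toReal_mul {α β : Type*} (p : PMF α) (k : α → PMF β) {f : β → ℝ} {C : ℝ}
    (hf : ∀ b, |f b| ≤ C) :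
    ∑' b, ((p.bind k) b).toReal * f b = ∑' a, (p a).toReal * ∑' b, (k a b).toReal * f b := by
  have hpk : Summable fun x : α × β => (p x.1 * k x.1 x.2).toReal := by
    refine ENNReal.summable_toReal ?_
    rw [ENNReal.tsum_prod (f := fun a b => p a * k a b)]
    simp [ENNReal.tsum_mul_left, PMF.tsum_coe]
  have hsum : Summable (Function.uncurry fun a b => (p a * k a b).toReal * f b) := by
    refine Summable.of_norm_bounded (hpk.mul_right C) fun x => ?_
    rw [Function.uncurry, norm_mul, Real.norm_of_nonneg ENNReal.toReal_nonneg]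
    exact mul_le_mul_of_nonneg_left (hf _) ENNReal.toReal_nonneg
  calc ∑' b, ((p.bind k) b).toReal * f b = ∑' b, ∑' a, (p a * k a b).toReal * f b := by
        refine tsum_congr fun b => ?_
        rw [PMF.bind_apply, ENNReal.tsum_toReal_eq, tsum_mul_right]
        exact fun a => ENNReal.mul_ne_top (p.apply_ne_top a) ((k a).apply_ne_top b)
    _ = ∑' a, ∑' b, (p a * k a b).toReal * f b := hsum.tsum_comm
    _ = _ := by simp_rw [ENNReal.toReal_mul, mul_assoc, tsum_mul_left]

section Operators

variable {S : Type*} [TopologicalSpace S]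

/-- The expectation of bounded functions, as a continuous linear functional. -/
def expectation (p : PMF S) : (S →ᵇ ℝ) →L[ℝ] ℝ :=
  LinearMap.mkContinuous
    { toFun := fun f => ∑' s, (p s).toReal * f s
      map_add' := fun f g => by
        simp only [BoundedContinuousFunction.coe_add, Pi.add_apply, mul_add]
        exact (summable_toReal_mul p f.norm_coe_le_norm).tsum_add
          (summable_toReal_mul p g.norm_coe_le_norm)
      map_smul' := fun c f => by
        simp only [BoundedContinuousFunction.coe_smul, smul_eq_mul, RingHom.id_apply,
          mul_left_comm _ c, tsum_mul_left] } 1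
    (fun f => by
      rw [one_mul]
      exact abs_tsum_toReal_mul_le p f.norm_coe_le_norm)

theorem expectation_apply (p : PMF S) (f : S →ᵇ ℝ) :
    expectation p f = ∑' s, (p s).toReal * f s := rfl

theorem norm_expectation_apply_le (p : PMF S) (f : S →ᵇ ℝ) : ‖expectation p f‖ ≤ ‖f‖ :=
  abs_tsum_toReal_mul_le p f.norm_coe_le_norm

theorem expectation_bind_fintype {α : Type*} [Fintype α] (p : PMF α) (k : α → PMF S)
    (f : S →ᵇ ℝ) : expectation (p.bind k) f = ∑ a, (p a).toReal * expectation (k a) f := by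
  rw [expectation_apply, tsum_bind_toReal_mul p k f.norm_coe_le_norm, tsum_fintype]
  rfl

variable [DiscreteTopology S]

/-- The action `f ↦ (s ↦ E_{k s} f)` of a Markov kernel on bounded functions. -/
def kernelOp (k : S → PMF S) : (S →ᵇ ℝ) →L[ℝ] (S →ᵇ ℝ) :=
  LinearMap.mkContinuous
    { toFun := fun f => BoundedContinuousFunction.ofNormedAddCommGroupDiscrete
        (fun s => expectation (k s) f) ‖f‖ (fun s => norm_expectation_apply_le (k s) f)
      map_add' := fun f g => by ext s; simp
      map_smul' := fun c f => by ext s; simp } 1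
    (fun f => by
      rw [one_mul]
      exact (BoundedContinuousFunction.norm_le (norm_nonneg f)).2
        fun s => norm_expectation_apply_le (k s) f)

theorem kernelOp_apply (k : S → PMF S) (f : S →ᵇ ℝ) (s : S) :
    kernelOp k f s = expectation (k s) f := rfl

theorem norm_kernelOp_le (k : S → PMF S) : ‖kernelOp k‖ ≤ 1 :=
  LinearMap.mkContinuous_norm_le _ zero_le_one _

theorem expectation_bind (p : PMF S) (k : S → PMF S) (f : S →ᵇ ℝ) :
    expectation (p.bind k) f = expectation p (kernelOp k f) :=
  tsum_bind_toReal_mul p k f.norm_coe_le_norm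

end Operators

/-! ### The return as a function of the joint parameter -/

section Return

variable {N d : ℕ} {S : Type*} {A O : Fin N → Type*}
  [TopologicalSpace S] [DiscreteTopology S]
  (M : DecPOMDP N S A O) (π : PolicyFamily N d A O)

theorem norm_toReal_le_one {α : Type*} (p : PMF α) (a : α) : ‖(p a).toReal‖ ≤ 1 := by
  rw [Real.norm_of_nonneg ENNReal.toReal_nonneg]
  exact ENNReal.toReal_le_of_le_ofReal zero_le_one (by simpa using p.coe_le_one a)

/-- The probability that agent `i` takes action `a`, as a function of the state. -/
def localProb (i : Fin N) (a : A i) (x : AgentParam d) : S →ᵇ ℝ :=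
  BoundedContinuousFunction.ofNormedAddCommGroupDiscrete
    (fun s => (π i (M.observe s i) x a).toReal) 1 (fun _ => norm_toReal_le_one _ _)

/-- The probability of a joint action, as a function of the state. -/
def jointProb (a : ∀ i, A i) (θ : JointParam N d) : S →ᵇ ℝ :=
  ∏ i, localProb M π i (a i) (θ i)

section

variable {M π} {Θ : Set (JointParam N d)} {θ : JointParam N d}

theorem IsC1Near.differentiableAt_localProb (hπ : IsC1Near π Θ) (hθ : θ ∈ Θ) (i : Fin N)
    (a : A i) : DifferentiableAt ℝ (localProb M π i a) (θ i) := by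
  obtain ⟨V, hV, hΘV, h⟩ := hπ i
  obtain ⟨hd, he⟩ := h a
  refine differentiableAt_bcf_of_equicontinuousOn (C := 1)
    (fun x => (BoundedContinuousFunction.norm_le zero_le_one).2 fun s => norm_toReal_le_one _ _)
    hV (hΘV θ hθ) (fun s => (hd (M.observe s i)).differentiableOn one_ne_zero) ?_
  -- Equicontinuity over observations passes to states by reindexing along `observe`.
  exact fun x hx U hU => (he x hx U hU).mono fun y hy s => hy (M.observe s i)

theorem IsC1Near.differentiableAt_jointProb (hπ : IsC1Near π Θ) (hθ : θ ∈ Θ)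
    (a : ∀ i, A i) : DifferentiableAt ℝ (jointProb M π a) θ := by
  have h (i : Fin N) : DifferentiableAt ℝ (fun θ' : JointParam N d =>
      localProb M π i (a i) (θ' i)) θ :=
    (hπ.differentiableAt_localProb hθ i (a i)).comp (f := fun θ' : JointParam N d => θ' i) θ
      (differentiableAt_apply i θ)
  exact (HasFDerivAt.finsetProd fun i _ => (h i).hasFDerivAt).differentiableAt

end

variable [∀ i, Fintype (A i)]

theorem jointProb_apply (a : ∀ i, A i) (θ : JointParam N d) (s : S) :
    jointProb M π a θ s = (jointAction M π θ s a).toReal := by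
  have h : jointProb M π a θ s = ∏ i, localProb M π i (a i) (θ i) s := by
    simp [jointProb]
  rw [h, jointAction, PMF.ofFintype_apply, ENNReal.toReal_prod]
  rfl

/-- The reward of a joint action, as a function of the state. -/
def actionReward (a : ∀ i, A i) : S →ᵇ ℝ :=
  BoundedContinuousFunction.ofNormedAddCommGroupDiscrete
    (fun s => M.reward s a) M.reward_bounded.choose
    (fun s => M.reward_bounded.choose_spec s a)

/-- The expected one-step reward, as a function of the state. -/
def policyReward (θ : JointParam N d) : S →ᵇ ℝ := ∑ a, jointProb M π a θ * actionReward M a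

/-- One step of the state process under the joint policy. -/
def policyKernel (θ : JointParam N d) (s : S) : PMF S :=
  (jointAction M π θ s).bind fun a => M.transition s a

/-- Isolates the dependence on `θ` in multiplication operators; the environment's operators are
constant. -/
theorem kernelOp_policyKernel (θ : JointParam N d) :
    kernelOp (policyKernel M π θ) =
      ∑ a, (ContinuousLinearMap.mul ℝ (S →ᵇ ℝ) (jointProb M π a θ)).comp
        (kernelOp fun s => M.transition s a) := by
  ext f s
  rw [kernelOp_apply, policyKernel, expectation_bind_fintype]
  simp [jointProb_apply, kernelOp_apply]

theorem expectation_stateLaw (θ : JointParam N d) (t : ℕ) (f : S →ᵇ ℝ) :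
    expectation (stateLaw M π θ t) f =
      expectation M.init ((kernelOp (policyKernel M π θ) ^ t) f) := by
  induction t generalizing f with
  | zero => rfl
  | succ t ih =>
    -- By duality, the last transition of the state law becomes the first operator applied to `f`,
    -- hence the induction over all `f`.
    rw [pow_succ, mul_apply_eq_comp, ← ih, ← expectation_bind]
    rfl

theorem expectedReward_eq (θ : JointParam N d) (t : ℕ) :
    expectedReward M π θ t =
      expectation M.init ((kernelOp (policyKernel M π θ) ^ t) (policyReward M π θ)) := by
  rw [← expectation_stateLaw, expectation_apply]
  refine tsum_congr fun s => ?_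
  congr 1
  simp [policyReward, jointProb_apply, actionReward]

theorem expectedReturn_eq (θ : JointParam N d) :
    expectedReturn M π θ = ∑' t : ℕ, M.discount ^ t *
      expectation M.init ((kernelOp (policyKernel M π θ) ^ t) (policyReward M π θ)) := by
  simp_rw [← expectedReward_eq]
  rfl

variable {M π} {Θ : Set (JointParam N d)} {θ : JointParam N d}

theorem IsC1Near.differentiableAt_policyReward (hπ : IsC1Near π Θ) (hθ : θ ∈ Θ) :
    DifferentiableAt ℝ (policyReward M π) θ :=
  DifferentiableAt.fun_sum fun a _ => (hπ.differentiableAt_jointProb hθ a).mul_const _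

theorem IsC1Near.differentiableAt_kernelOp (hπ : IsC1Near π Θ) (hθ : θ ∈ Θ) :
    DifferentiableAt ℝ (fun θ' => kernelOp (policyKernel M π θ')) θ := by
  simp_rw [kernelOp_policyKernel]
  exact differentiableAt_sum_mul_comp _ fun a => hπ.differentiableAt_jointProb hθ a

theorem IsC1Near.differentiableAt_expectedReturn (hπ : IsC1Near π Θ) (hθ : θ ∈ Θ) :
    DifferentiableAt ℝ (expectedReturn M π) θ := by
  rw [funext (expectedReturn_eq M π)]
  exact differentiableAt_tsum_pow_mul M.discount_nonneg M.discount_lt_one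
    (fun _ => norm_kernelOp_le _) (expectation M.init) (hπ.differentiableAt_kernelOp hθ)
    (hπ.differentiableAt_policyReward hθ)

end Return

/-- At a maximizer of the return over a convex set preserved by the update, all local gradients
vanish. -/
theorem localGradient_eq_zero_of_isMaxOn {N d : ℕ} [NeZero N] {S : Type*} {A O : Fin N → Type*}
    [∀ i, Fintype (A i)] {M : DecPOMDP N S A O} {π : PolicyFamily N d A O}
    {Θ : Set (JointParam N d)} (hconvex : Convex ℝ Θ) {η : ℝ} (hη : 0 < η)
    {θ : JointParam N d} (hθ : θ ∈ Θ) (hθ' : update M π η θ ∈ Θ)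
    (hmax : IsMaxOn (expectedReturn M π) Θ θ)
    (hd : DifferentiableAt ℝ (expectedReturn M π) θ) :
    localGradient M π θ = 0 ∧ consensusGradient M π θ = 0 := by
  set g := localGradient M π θ with hg
  set u := consensusGradient M π θ with hu
  have h := fderiv_sub_nonpos_of_isMaxOn hconvex hθ hθ' hmax hd
  rw [fderiv_apply_eq_sum_inner_gradient hd] at h
  have hterm (i : Fin N) : inner ℝ (gradient (fun x => expectedReturn M π (Function.update θ i x))
      (θ i)) ((update M π η θ - θ) i) = η * (‖g i‖ ^ 2 + inner ℝ u (g i)) := by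
    change inner ℝ (g i) (θ i + η • (g i + u) - θ i) = _
    rw [add_sub_cancel_left, inner_smul_right, inner_add_right, real_inner_self_eq_norm_sq,
      real_inner_comm]
  simp_rw [hterm, ← Finset.mul_sum] at h
  have hu_le (i : Fin N) : ‖u‖ ^ 2 ≤ inner ℝ u (g i) := norm_sq_minNormPoint_le_inner g i
  have hnonneg : ∀ i ∈ Finset.univ, 0 ≤ ‖g i‖ ^ 2 + inner ℝ u (g i) := fun i _ => by
    nlinarith [hu_le i, sq_nonneg ‖u‖, sq_nonneg ‖g i‖]
  have hzero := (Finset.sum_eq_zero_iff_of_nonneg hnonneg).1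
    (le_antisymm (nonpos_of_mul_nonpos_right h hη) (Finset.sum_nonneg hnonneg))
  constructor
  · funext i
    have h1 : ‖g i‖ ^ 2 = 0 := by
      nlinarith [hu_le i, sq_nonneg ‖u‖, sq_nonneg ‖g i‖, hzero i (Finset.mem_univ i)]
    simpa using h1
  · have h1 : ‖u‖ ^ 2 = 0 := by
      -- Any single agent suffices; agent `0` exists because `N ≠ 0`.
      nlinarith [hu_le 0, sq_nonneg ‖u‖, sq_nonneg ‖g 0‖, hzero 0 (Finset.mem_univ 0)]
    simpa using h1

end GRASP

end

theorem theorem2 {N d : ℕ} [NeZero N] {S : Type*} {A : Fin N → Type*} {O : Fin N → Type*}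
    [∀ i, Fintype (A i)] (M : GRASP.DecPOMDP N S A O) (π : GRASP.PolicyFamily N d A O)
    (Θ : Set (GRASP.JointParam N d)) (hne : Θ.Nonempty) (hcompact : IsCompact Θ)
    (hconvex : Convex ℝ Θ) (hπ : GRASP.IsC1Near π Θ) (η : ℝ) (hη : 0 < η)
    (hmaps : Set.MapsTo (GRASP.update M π η) Θ Θ) :
    ∃ θ ∈ Θ, Function.IsFixedPt (GRASP.update M π η) θ ∧
      GRASP.IsConsensusEquilibrium M π θ := by
  have hd : ∀ θ ∈ Θ, DifferentiableAt ℝ (GRASP.expectedReturn M π) θ :=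
    fun θ hθ =>
      -- With the discrete topology, bounded continuous functions on `S` are all bounded functions.
      let : TopologicalSpace S := ⊥
      have : DiscreteTopology S := ⟨rfl⟩
      hπ.differentiableAt_expectedReturn hθ
  obtain ⟨θ, hθ, hmax⟩ := hcompact.exists_isMaxOn hne
    fun θ hθ => (hd θ hθ).continuousAt.continuousWithinAt
  obtain ⟨hg, hu⟩ := GRASP.localGradient_eq_zero_of_isMaxOn hconvex hη hθ (hmaps hθ) hmax
    (hd θ hθ)
  refine ⟨θ, hθ, ?_, hu⟩
  funext i
  simp [GRASP.update, hg, hu]
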